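/- Let $n,a,b\ge 1$ be integers with $ab\mid n$, and suppose that it is not the case that both $b=1$ and $a<n$. Let $G=C(n;a,b)$ be the one-paired circulant, i.e. the graph on $\{0,1,\dots,n-1\}$ in which $u$ and $v$ are adjacent if and only if $|u-v|\in S$ or $n-|u-v|\in S$, where $$S=\{d\in\{1,\dots,\lfloor n/2\rfloor\} : a\mid d \text{ and } ab\nmid d\}.$$ Let $\mathrm{Ind}(G)$ be the simplicial complex of independent sets of $G$ (with $\emptyset$ as a face), and let $k$ be any field. A simplicial complex $\Delta$ is pure if all its facets have the same size. A pure complex $\Delta$ is - vertex decomposable if it is a simplex (its set of all vertices is a face; $\{\emptyset\}$ is included) or it has a vertex $x$ such that the link and the deletion of $x$ are both (pure and) vertex decomposable; - shellable if its facets can be ordered $F_1,\dots,F_t$ so that for all $j<i$ there are $x\in F_i\setminus F_j$ and $l<i$ with $F_i\setminus F_l=\{x\}$; - Cohen-Macaulay (over $k$) if for all faces $F$ and all $i<\dim \mathrm{link}_\Delta(F)$ one has $\tilde H_i(\mathrm{link}_\Delta(F);k)=0$; - Buchsbaum (over $k$) if the link of every vertex is Cohen-Macaulay over $k$. Say that $G$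 has one of these properties if $\mathrm{Ind}(G)$ does. Then: (i) each of the three properties "$G$ is vertex decomposable", "$G$ is shellable", "$G$ is Cohen-Macaulay" holds if and only if $n=ab$; (ii) $G$ is Buchsbaum but not Cohen-Macaulay if and only if $a=1$ and $ab<n$; (iii) $\mathrm{Ind}(G)$ is pure but not Buchsbaum if and only if $a>1$ and $ab<n$. -/

import Mathlib

/-- A (finite) abstract simplicial complex with vertices among the elements of `V`. As in
combinatorial commutative algebra, the empty set is always a face (of dimension `-1`).
Mathlib's `AbstractSimplicialComplex` has only nonempty faces and makes every element of the
ambient type a vertex; neither is suitable for links, deletions and reduced homology. -/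
structure SimpComplex (V : Type*) where
  faces : Finset (Finset V)
  empty_mem : ∅ ∈ faces
  down_closed : ∀ F ∈ faces, ∀ G, G ⊆ F → G ∈ faces

namespace SimpComplex

variable {V : Type*}

/-- Facets are the faces that are maximal with respect to inclusion. -/
def IsFacet (Δ : SimpComplex V) (F : Finset V) : Prop :=
  Maximal (fun G => G ∈ Δ.faces) F

/-- All facets have the same dimension. -/
def IsPure (Δ : SimpComplex V) : Prop :=
  ∀ F G, Δ.IsFacet F → Δ.IsFacet G → F.card = G.card

/-- The dimension, `max (|F| - 1)` over all faces `F`; it is `-1` for the complex `{∅}`. -/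
def dim (Δ : SimpComplex V) : ℤ :=
  ((Δ.faces.sup Finset.card : ℕ) : ℤ) - 1

section Decidable

variable [DecidableEq V]

/-- The set of all vertices of the complex (the elements that lie in some face). -/
def vertices (Δ : SimpComplex V) : Finset V :=
  Δ.faces.biUnion id

/-- A simplex: the set of all vertices is the unique facet. -/
def IsSimplex (Δ : SimpComplex V) : Prop :=
  ∀ F, Δ.IsFacet F ↔ F = Δ.vertices

/-- The link of a face `F`. -/
def link (Δ : SimpComplex V) (F : Finset V) (hF : F ∈ Δ.faces) : SimpComplex V where
  faces := Δ.faces.filter (fun G => Disjoint F G ∧ F ∪ G ∈ Δ.faces)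
  empty_mem := by simp [Δ.empty_mem, hF]
  down_closed := by
    intro G hG H hHG
    rw [Finset.mem_filter] at hG ⊢
    exact ⟨Δ.down_closed G hG.1 H hHG, hG.2.1.mono_right hHG,
      Δ.down_closed _ hG.2.2 _ (Finset.union_subset_union_right hHG)⟩

/-- The deletion of a vertex `x`: all faces that do not contain `x`. -/
def deletion (Δ : SimpComplex V) (x : V) : SimpComplex V where
  faces := Δ.faces.filter (fun G => ¬ {x} ⊆ G)
  empty_mem := by simp [Δ.empty_mem]
  down_closed := by
    intro G hG H hHG
    rw [Finset.mem_filter] at hG ⊢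
    exact ⟨Δ.down_closed G hG.1 H hHG, fun h => hG.2 (h.trans hHG)⟩

/-- (Pure) vertex decomposability. A simplex is pure, so that the first constructor
does not mention purity. -/
inductive VertexDecomposable : SimpComplex V → Prop
  | simplex (Δ : SimpComplex V) (h : Δ.IsSimplex) : VertexDecomposable Δ
  | shed (Δ : SimpComplex V) (hpure : Δ.IsPure) (x : V) (hx : {x} ∈ Δ.faces)
      (hlink : VertexDecomposable (Δ.link {x} hx))
      (hdel : VertexDecomposable (Δ.deletion x)) : VertexDecomposable Δ

/-- (Pure) shellability: the facets can be listed without repetition as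
`F 0, F 1, …, F (t - 1)` such that for all `j < i` there are `x ∈ F i \ F j`
and `l < i` with `F i \ F l = {x}`. -/
def Shellable (Δ : SimpComplex V) : Prop :=
  Δ.IsPure ∧ ∃ (t : ℕ) (F : Fin t → Finset V),
    Function.Injective F ∧ (∀ G, Δ.IsFacet G ↔ ∃ i, F i = G) ∧
    ∀ i j, j < i → ∃ x ∈ F i \ F j, ∃ l, l < i ∧ F i \ F l = {x}

end Decidable

section Homology

variable (k : Type*) [Field k] [LinearOrder V]

/-- The simplicial boundary map of the oriented augmented chain complex on all finite subsets
of the linearly ordered set `V`: the set `{v₀ < ⋯ < vᵢ}` is sent to the alternating sum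
`∑ⱼ (-1)ʲ {v₀, …, vᵢ} \ {vⱼ}`. In particular a point is sent to `∅`, and `∅` to `0`. -/
noncomputable def boundary : (Finset V →₀ k) →ₗ[k] (Finset V →₀ k) :=
  Finsupp.linearCombination k (fun s : Finset V =>
    ∑ x ∈ s, Finsupp.single (s.erase x) ((-1 : k) ^ (s.filter (fun y => y < x)).card))

/-- The oriented `i`-chains of `Δ`: the formal combinations of faces of dimension `i`. -/
noncomputable def chains (Δ : SimpComplex V) (i : ℤ) : Submodule k (Finset V →₀ k) :=
  Finsupp.supported k k {s : Finset V | s ∈ Δ.faces ∧ (s.card : ℤ) - 1 = i}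

/-- The reduced `i`-cycles of `Δ`. -/
noncomputable def cycles (Δ : SimpComplex V) (i : ℤ) : Submodule k (Finset V →₀ k) :=
  Δ.chains k i ⊓ LinearMap.ker (boundary k)

/-- The reduced `i`-boundaries of `Δ`. -/
noncomputable def boundaries (Δ : SimpComplex V) (i : ℤ) : Submodule k (Finset V →₀ k) :=
  (Δ.chains k (i + 1)).map (boundary k)

/-- The reduced simplicial homology `H̃ᵢ(Δ; k) = Zᵢ / Bᵢ`: the cycles modulo the boundaries
(realized as the image of the submodule `Zᵢ` in the quotient by `Bᵢ`). -/
abbrev ReducedHomology (Δ : SimpComplex V) (i : ℤ) : Type _ :=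
  (Δ.cycles k i).map (Δ.boundaries k i).mkQ

/-- (Pure) Cohen–Macaulay complexes over `k`: the reduced homology of every link vanishes
below the dimension of that link. -/
def CohenMacaulay (Δ : SimpComplex V) : Prop :=
  Δ.IsPure ∧ ∀ (F : Finset V) (hF : F ∈ Δ.faces) (i : ℤ), i < (Δ.link F hF).dim →
    Subsingleton ((Δ.link F hF).ReducedHomology k i)

/-- (Pure) Buchsbaum complexes over `k`: the link of every vertex is Cohen–Macaulay. -/
def Buchsbaum (Δ : SimpComplex V) : Prop :=
  Δ.IsPure ∧ ∀ (x : V) (hx : {x} ∈ Δ.faces), (Δ.link {x} hx).CohenMacaulay k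

end Homology

end SimpComplex

open Classical in
/-- The independence complex of a finite graph. -/
noncomputable def indComplex {V : Type*} [Fintype V] (G : SimpleGraph V) : SimpComplex V where
  faces := Finset.univ.filter (fun W : Finset V => G.IsIndepSet (W : Set V))
  empty_mem := by simp [SimpleGraph.isIndepSet_iff]
  down_closed := by
    intro F hF H hHF
    simp only [Finset.mem_filter, Finset.mem_univ, true_and] at hF ⊢
    exact hF.mono (Finset.coe_subset.mpr hHF)

/-- The circulant graph `Cₙ(S)` on `{0, …, n - 1}`, for `S ⊆ {1, …, ⌊n/2⌋}`. The subtraction in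
Mathlib's `circulantGraph` is that of `Fin n`, i.e. modulo `n`; so distinct `u`, `v` are adjacent
if and only if `|u - v| ∈ S` or `n - |u - v| ∈ S`. -/
def circulant (n : ℕ) [NeZero n] (S : Set ℕ) : SimpleGraph (Fin n) :=
  SimpleGraph.circulantGraph {d : Fin n | (d : ℕ) ∈ S}

/-- The one-paired circulant `C(n; a, b)` (for positive `a`, `b` with `a * b ∣ n`). -/
def onePairedCirculant (n : ℕ) [NeZero n] (a b : ℕ) : SimpleGraph (Fin n) :=
  circulant n {d | 1 ≤ d ∧ d ≤ n / 2 ∧ a ∣ d ∧ ¬ a * b ∣ d}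

/-!
The independence complex of `C(n; a, b)` is the join, over the residues modulo `a`, of disjoint
unions of simplices on the residue classes modulo `ab`. If `n = ab`, these simplices are points:
shedding vertices one at a time shows that the complex is vertex decomposable, and vertex
decomposable complexes are shellable, hence Cohen–Macaulay, because attaching a facet along a pure
subcomplex of codimension one creates no homology below the top dimension. If `n > ab`, take one
facet from each join factor but one. The link of their union is the remaining factor, which is
disconnected of positive dimension, so the complex is not Cohen–Macaulay. This union is nonempty,
and thus contains a vertex, precisely when `a > 1`; when `a = 1` the links of vertices are
simplices.
-/

namespace SimpComplex

section Faces

variable {V : Type*} {Δ : SimpComplex V} {F G : Finset V}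

@[ext]
theorem ext {Δ Γ : SimpComplex V} (h : ∀ F, F ∈ Δ.faces ↔ F ∈ Γ.faces) : Δ = Γ := by
  cases Δ
  cases Γ
  congr
  exact Finset.ext h

theorem IsFacet.eq_of_subset (hF : Δ.IsFacet F) (hG : G ∈ Δ.faces) (h : F ⊆ G) : F = G :=
  Maximal.eq_of_le hF hG h

theorem exists_isFacet_superset (hF : F ∈ Δ.faces) : ∃ G, Δ.IsFacet G ∧ F ⊆ G := by
  obtain ⟨G, hFG, hG⟩ := Δ.faces.exists_le_maximal hF
  exact ⟨G, hG, hFG⟩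

theorem card_sub_one_le_dim (hF : F ∈ Δ.faces) : (F.card : ℤ) - 1 ≤ Δ.dim := by
  have : F.card ≤ Δ.faces.sup Finset.card := Finset.le_sup hF
  rw [dim]
  omega

theorem IsPure.dim_eq (h : Δ.IsPure) (hF : Δ.IsFacet F) : Δ.dim = (F.card : ℤ) - 1 := by
  refine le_antisymm ?_ (card_sub_one_le_dim hF.1)
  have hsup : Δ.faces.sup Finset.card ≤ F.card := Finset.sup_le fun G hG => by
    obtain ⟨H, hH, hGH⟩ := exists_isFacet_superset hG
    exact (Finset.card_le_card hGH).trans_eq (h H F hH hF)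
  rw [dim]
  omega

variable [DecidableEq V]

theorem IsFacet.mem_of_insert_mem (hF : Δ.IsFacet F) {x : V} (h : insert x F ∈ Δ.faces) :
    x ∈ F := by
  rw [hF.eq_of_subset h (Finset.subset_insert x F)]
  exact Finset.mem_insert_self x F

theorem isSimplex_of_mem_faces_iff {A : Finset V} (h : ∀ F, F ∈ Δ.faces ↔ F ⊆ A) :
    Δ.IsSimplex := by
  have hA : A ∈ Δ.faces := (h A).2 subset_rfl
  have hvert : Δ.vertices = A := (Finset.biUnion_subset.2 fun F hF => (h F).1 hF).antisymm
    (Finset.subset_biUnion_of_mem id hA)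
  intro F
  rw [hvert]
  constructor
  · exact fun hF => hF.eq_of_subset hA ((h F).1 hF.1)
  · rintro rfl
    exact ⟨hA, fun G hG _ => (h G).1 hG⟩

theorem mem_link {hF : F ∈ Δ.faces} :
    G ∈ (Δ.link F hF).faces ↔ Disjoint F G ∧ F ∪ G ∈ Δ.faces := by
  simp only [link, Finset.mem_filter, and_iff_right_iff_imp]
  exact fun h => Δ.down_closed _ h.2 _ Finset.subset_union_right

theorem link_empty : Δ.link ∅ Δ.empty_mem = Δ := by
  ext G
  simp [mem_link]

theorem link_link {hF : F ∈ Δ.faces} (hG : G ∈ (Δ.link F hF).faces) :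
    (Δ.link F hF).link G hG = Δ.link (F ∪ G) (mem_link.1 hG).2 := by
  ext H
  have hFG := (mem_link.1 hG).1
  simp only [mem_link, Finset.disjoint_union_left, Finset.disjoint_union_right,
    Finset.union_assoc]
  tauto

theorem isFacet_link_iff {hF : F ∈ Δ.faces} :
    (Δ.link F hF).IsFacet G ↔ Disjoint F G ∧ Δ.IsFacet (F ∪ G) := by
  constructor
  · intro hG
    have hFG := mem_link.1 hG.1
    refine ⟨hFG.1, hFG.2, fun H hH hle => ?_⟩
    have hFH : F ∪ H \ F = H := Finset.union_sdiff_of_subset (Finset.subset_union_left.trans hle)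
    have hmem : H \ F ∈ (Δ.link F hF).faces := mem_link.2 ⟨Finset.disjoint_sdiff, by rwa [hFH]⟩
    rw [hG.eq_of_subset hmem (Finset.subset_sdiff.2
      ⟨Finset.subset_union_right.trans hle, hFG.1.symm⟩), hFH]
  · rintro ⟨hdisj, hFG⟩
    refine ⟨mem_link.2 ⟨hdisj, hFG.1⟩, fun H hH hle => ?_⟩
    obtain ⟨hFH, hmem⟩ := mem_link.1 hH
    have hHG : H ⊆ F ∪ G := by
      rw [hFG.eq_of_subset hmem (Finset.union_subset_union_right hle)]
      exact Finset.subset_union_right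
    exact hFH.symm.left_le_of_le_sup_left hHG

theorem isFacet_link_erase_iff {x : V} {hx : {x} ∈ Δ.faces} (hxF : x ∈ F) :
    (Δ.link {x} hx).IsFacet (F.erase x) ↔ Δ.IsFacet F := by
  simp [isFacet_link_iff, Finset.insert_erase hxF]

theorem IsPure.link (h : Δ.IsPure) (hF : F ∈ Δ.faces) : (Δ.link F hF).IsPure := by
  intro G H hG hH
  rw [isFacet_link_iff] at hG hH
  have := h _ _ hG.2 hH.2
  rwa [Finset.card_union_of_disjoint hG.1, Finset.card_union_of_disjoint hH.1,
    add_right_inj] at this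

theorem mem_deletion {x : V} : F ∈ (Δ.deletion x).faces ↔ F ∈ Δ.faces ∧ x ∉ F := by
  simp [deletion]

theorem IsFacet.deletion (hF : Δ.IsFacet F) {x : V} (hx : x ∉ F) : (Δ.deletion x).IsFacet F :=
  ⟨mem_deletion.2 ⟨hF.1, hx⟩, fun _ hG => hF.2 (mem_deletion.1 hG).1⟩

theorem IsPure.isFacet_of_isFacet_deletion (h : Δ.IsPure) {x : V} (hdel : (Δ.deletion x).IsPure)
    (hF : Δ.IsFacet F) (hx : x ∉ F) (hG : (Δ.deletion x).IsFacet G) : Δ.IsFacet G := by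
  obtain ⟨H, hH, hGH⟩ := exists_isFacet_superset (mem_deletion.1 hG.1).1
  have hcard : H.card = G.card := (h H F hH hF).trans (hdel F G (hF.deletion hx) hG)
  rwa [Finset.eq_of_subset_of_card_le hGH hcard.le]

end Faces

section Shelling

variable {V : Type*} [DecidableEq V] {Δ : SimpComplex V} {F : Finset V}

/-- A shelling order encoded by a weight `r` on the facets. Facets of equal weight may be listed
in any order, so `r` need not be injective. -/
def IsShellingRank (Δ : SimpComplex V) (r : Finset V → ℕ) : Prop :=
  ∀ F G, Δ.IsFacet F → Δ.IsFacet G → F ≠ G → r G ≤ r F →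
    ∃ x ∈ F \ G, ∃ H, Δ.IsFacet H ∧ r H < r F ∧ F \ H = {x}

theorem Shellable.exists_isShellingRank (h : Δ.Shellable) : ∃ r, Δ.IsShellingRank r := by
  obtain ⟨_, t, E, hinj, hfacet, hshell⟩ := h
  refine ⟨Function.extend E (fun i => (i : ℕ)) 0, fun F G hF hG hne hle => ?_⟩
  obtain ⟨i, rfl⟩ := (hfacet F).1 hF
  obtain ⟨j, rfl⟩ := (hfacet G).1 hG
  simp only [hinj.extend_apply] at hle ⊢
  obtain ⟨x, hx, l, hl, hd⟩ := hshell i j (lt_of_le_of_ne hle fun h => hne (congrArg E h.symm))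
  exact ⟨x, hx, E l, (hfacet _).2 ⟨l, rfl⟩, by rwa [hinj.extend_apply], hd⟩

theorem IsShellingRank.shellable {r : Finset V → ℕ} (hr : Δ.IsShellingRank r)
    (hpure : Δ.IsPure) : Δ.Shellable := by
  classical
  let S : Finset (Finset V) := Δ.faces.filter Δ.IsFacet
  have hS : ∀ F, F ∈ S ↔ Δ.IsFacet F := fun F => by
    simpa [S] using fun h : Δ.IsFacet F => h.1
  let σ : Fin S.card ≃ Fin S.card := Tuple.sort fun i => r (S.equivFin.symm i)
  let e : Fin S.card ≃ S := σ.trans S.equivFin.symm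
  have hmono : Monotone fun i => r (e i) := Tuple.monotone_sort fun i => r (S.equivFin.symm i)
  have hfacet : ∀ G, Δ.IsFacet G ↔ ∃ i, (e i : Finset V) = G := fun G => by
    rw [← hS]
    exact ⟨fun hG => ⟨e.symm ⟨G, hG⟩, by simp⟩, by rintro ⟨i, rfl⟩; exact (e i).2⟩
  have hinj : Function.Injective fun i => (e i : Finset V) :=
    Subtype.val_injective.comp e.injective
  refine ⟨hpure, S.card, fun i => e i, hinj, hfacet, fun i j hji => ?_⟩
  obtain ⟨x, hx, H, hH, hlt, hd⟩ := hr (e i) (e j) ((hfacet _).2 ⟨i, rfl⟩)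
    ((hfacet _).2 ⟨j, rfl⟩) (hinj.ne hji.ne') (hmono hji.le)
  obtain ⟨l, rfl⟩ := (hfacet H).1 hH
  exact ⟨x, hx, l, hmono.reflect_lt hlt, hd⟩

theorem IsShellingRank.link {r : Finset V → ℕ} (hr : Δ.IsShellingRank r) (hF : F ∈ Δ.faces) :
    (Δ.link F hF).IsShellingRank fun G => r (F ∪ G) := by
  intro G G' hG hG' hne hle
  rw [isFacet_link_iff] at hG hG'
  have hne' : F ∪ G ≠ F ∪ G' := fun h => hne <| by
    rw [← Finset.union_sdiff_cancel_left hG.1, h, Finset.union_sdiff_cancel_left hG'.1]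
  obtain ⟨x, hx, H, hH, hlt, hd⟩ := hr _ _ hG.2 hG'.2 hne' hle
  have hFH : F ⊆ H := fun y hy => by
    by_contra hyH
    have hyx : y = x := by
      rw [← Finset.mem_singleton, ← hd]
      exact Finset.mem_sdiff.2 ⟨Finset.mem_union_left G hy, hyH⟩
    exact (Finset.mem_sdiff.1 hx).2 (Finset.mem_union_left G' (hyx ▸ hy))
  have hFH' : F ∪ H \ F = H := Finset.union_sdiff_of_subset hFH
  refine ⟨x, ?_, H \ F, isFacet_link_iff.2 ⟨Finset.disjoint_sdiff, by rwa [hFH']⟩, ?_, ?_⟩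
  · simp only [Finset.mem_sdiff, Finset.mem_union] at hx ⊢
    tauto
  · simpa only [hFH'] using hlt
  · rw [← hd]
    ext y
    have hyd := fun h : y ∈ F => Finset.disjoint_left.1 hG.1 h
    have := @hFH y
    simp only [Finset.mem_sdiff, Finset.mem_union]
    tauto

theorem Shellable.link (h : Δ.Shellable) (hF : F ∈ Δ.faces) : (Δ.link F hF).Shellable :=
  let ⟨_, hr⟩ := h.exists_isShellingRank
  (hr.link hF).shellable (h.1.link hF)

-- List the facets avoiding `x` first, then those containing `x`.
theorem IsShellingRank.exists_of_link_of_deletion (hpure : Δ.IsPure) {x : V} {hx : {x} ∈ Δ.faces}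
    (hdel : (Δ.deletion x).IsPure) {r s : Finset V → ℕ}
    (hr : (Δ.link {x} hx).IsShellingRank r) (hs : (Δ.deletion x).IsShellingRank s) :
    ∃ w, Δ.IsShellingRank w := by
  let N := (Δ.deletion x).faces.sup s + 1
  have hN : ∀ {F}, (Δ.deletion x).IsFacet F → s F < N := fun hF =>
    Nat.lt_succ_of_le (Finset.le_sup hF.1)
  refine ⟨fun F => if x ∈ F then N + r (F.erase x) else s F, fun F G hF hG hne hle => ?_⟩
  by_cases hxF : x ∈ F <;> by_cases hxG : x ∈ G <;>
    simp only [hxF, hxG, if_true, if_false] at hle ⊢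
  · obtain ⟨y, hy, H, hH, hlt, hd⟩ := hr _ _ ((isFacet_link_erase_iff hxF).2 hF)
      ((isFacet_link_erase_iff hxG).2 hG)
      (fun h => hne (by rw [← Finset.insert_erase hxF, h, Finset.insert_erase hxG]))
      (Nat.le_of_add_le_add_left hle)
    rw [isFacet_link_iff, Finset.disjoint_singleton_left, ← Finset.insert_eq] at hH
    refine ⟨y, ?_, insert x H, hH.2, ?_, ?_⟩
    · simp only [Finset.mem_sdiff, Finset.mem_erase] at hy ⊢
      tauto
    · simpa [Finset.erase_insert hH.1] using hlt
    · rw [Finset.sdiff_insert, ← Finset.erase_sdiff_comm, hd]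
  · obtain ⟨K, hK, hFK⟩ := exists_isFacet_superset (Δ := Δ.deletion x) (F := F.erase x)
      (mem_deletion.2 ⟨Δ.down_closed F hF.1 _ (F.erase_subset x), F.notMem_erase x⟩)
    have hxK : x ∉ K := (mem_deletion.1 hK.1).2
    refine ⟨x, Finset.mem_sdiff.2 ⟨hxF, hxG⟩, K,
      hpure.isFacet_of_isFacet_deletion hdel hG hxG hK, ?_, ?_⟩
    · rw [if_neg hxK]
      exact (hN hK).trans_le (Nat.le_add_right N _)
    · rw [← Finset.insert_erase hxF, Finset.insert_sdiff_of_notMem _ hxK,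
        Finset.sdiff_eq_empty_iff_subset.2 hFK, insert_empty_eq]
  · exact absurd hle (not_le.2 ((hN (hF.deletion hxF)).trans_le (Nat.le_add_right N _)))
  · obtain ⟨y, hy, H, hH, hlt, hd⟩ := hs F G (hF.deletion hxF) (hG.deletion hxG) hne hle
    refine ⟨y, hy, H, hpure.isFacet_of_isFacet_deletion hdel hF hxF hH, ?_, hd⟩
    rwa [if_neg (mem_deletion.1 hH.1).2]

theorem VertexDecomposable.isPure (h : Δ.VertexDecomposable) : Δ.IsPure := by
  cases h with
  | simplex _ h => exact fun F G hF hG => by rw [(h F).1 hF, (h G).1 hG]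
  | shed _ h => exact h

theorem VertexDecomposable.shellable (h : Δ.VertexDecomposable) : Δ.Shellable := by
  suffices hr : ∃ r, Δ.IsShellingRank r from hr.elim fun _ hr => hr.shellable h.isPure
  induction h with
  | simplex Δ h =>
    exact ⟨0, fun F G hF hG hne => absurd (((h F).1 hF).trans ((h G).1 hG).symm) hne⟩
  | shed Δ hpure x hx _ hdel ihlink ihdel =>
    obtain ⟨r, hr⟩ := ihlink
    obtain ⟨s, hs⟩ := ihdel
    exact IsShellingRank.exists_of_link_of_deletion hpure hdel.isPure hr hs

end Shelling

section FamilyChains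

variable (k : Type*) [Field k] {V : Type*}

/-- The `i`-chains supported on a family `S` of finite sets. Unlike the faces of a `SimpComplex`,
the family may be empty. -/
noncomputable def familyChains (S : Set (Finset V)) (i : ℤ) : Submodule k (Finset V →₀ k) :=
  Finsupp.supported k k {s | s ∈ S ∧ (s.card : ℤ) - 1 = i}

variable {k} {S T : Set (Finset V)} {i : ℤ}

theorem familyChains_mono (h : ∀ s ∈ S, (s.card : ℤ) - 1 = i → s ∈ T) :
    familyChains k S i ≤ familyChains k T i :=
  Finsupp.supported_mono fun s hs => ⟨h s hs.1 hs.2, hs.2⟩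

theorem familyChains_union :
    familyChains k (S ∪ T) i = familyChains k S i ⊔ familyChains k T i := by
  rw [familyChains, familyChains, familyChains, ← Finsupp.supported_union]
  congr 1
  ext s
  simp [or_and_right]

theorem familyChains_inter :
    familyChains k (S ∩ T) i = familyChains k S i ⊓ familyChains k T i := by
  rw [familyChains, familyChains, familyChains, ← Finsupp.supported_inter]
  congr 1
  ext s
  simp only [Set.mem_ofPred_eq, Set.mem_inter_iff]
  tauto

theorem linearCombination_mem_of_mem_familyChains {M : Type*} [AddCommGroup M] [Module k M]
    {c : Finset V →₀ k} {f : Finset V → M} {N : Submodule k M}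
    (h : ∀ s ∈ S, (s.card : ℤ) - 1 = i → f s ∈ N)
    (hc : c ∈ familyChains k S i) : Finsupp.linearCombination k f c ∈ N := by
  rw [Finsupp.linearCombination_apply]
  exact N.sum_mem fun s hs => N.smul_mem _ (h s (hc hs).1 (hc hs).2)

end FamilyChains

section Homology

variable (k : Type*) [Field k] {V : Type*} [LinearOrder V]

/-- The sign with which `s.erase x` occurs in the boundary of `s`, and `insert x s` in the join
of `x` and `s`. -/
def incidenceSign (x : V) (s : Finset V) : k :=
  (-1) ^ (s.filter (fun y => y < x)).card

theorem incidenceSign_mul_self (x : V) (s : Finset V) :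
    incidenceSign k x s * incidenceSign k x s = 1 := by
  rw [incidenceSign, ← mul_pow, neg_one_mul, neg_neg, one_pow]

theorem incidenceSign_insert_self (x : V) (s : Finset V) :
    incidenceSign k x (insert x s) = incidenceSign k x s := by
  rw [incidenceSign, incidenceSign, Finset.filter_insert, if_neg (lt_irrefl x)]

theorem incidenceSign_insert_of_gt {x y : V} (h : x < y) (s : Finset V) :
    incidenceSign k x (insert y s) = incidenceSign k x s := by
  rw [incidenceSign, incidenceSign, Finset.filter_insert, if_neg h.not_gt]

theorem incidenceSign_insert_of_lt {x y : V} (h : y < x) {s : Finset V} (hy : y ∉ s) :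
    incidenceSign k x (insert y s) = -incidenceSign k x s := by
  rw [incidenceSign, incidenceSign, Finset.filter_insert, if_pos h,
    Finset.card_insert_of_notMem (by simp [hy]), pow_succ, mul_neg_one]

theorem incidenceSign_mul_incidenceSign_insert {x y : V} (hxy : x ≠ y) {s : Finset V} (hx : x ∉ s)
    (hy : y ∉ s) :
    incidenceSign k x (insert y s) * incidenceSign k y (insert x (insert y s)) =
      -(incidenceSign k y (insert y s) * incidenceSign k x s) := by
  rw [Finset.insert_comm, incidenceSign_insert_self, incidenceSign_insert_self]
  rcases hxy.lt_or_gt with h | h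
  · rw [incidenceSign_insert_of_gt k h, incidenceSign_insert_of_lt k h hx]
    ring
  · rw [incidenceSign_insert_of_lt k h hy, incidenceSign_insert_of_gt k h]
    ring

theorem boundary_single (s : Finset V) (c : k) :
    boundary k (Finsupp.single s c) =
      ∑ x ∈ s, Finsupp.single (s.erase x) (c * incidenceSign k x s) := by
  simp [boundary, incidenceSign, Finset.smul_sum]

theorem boundary_single_singleton (x : V) (c : k) :
    boundary k (Finsupp.single {x} c) = Finsupp.single ∅ c := by
  have hx : incidenceSign k x {x} = 1 := by simp [incidenceSign, Finset.filter_singleton]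
  rw [boundary_single, Finset.sum_singleton, Finset.erase_singleton, hx, mul_one]

theorem boundary_single_pair {x y : V} (h : x < y) (c : k) :
    boundary k (Finsupp.single {x, y} c) = Finsupp.single {y} c - Finsupp.single {x} c := by
  have hx : incidenceSign k x {x, y} = 1 := by
    simp [incidenceSign, Finset.filter_insert, Finset.filter_singleton, h.not_gt]
  have hy : incidenceSign k y {x, y} = -1 := by
    simp [incidenceSign, Finset.filter_insert, Finset.filter_singleton, h]
  have hxy : ({x, y} : Finset V).erase x = {y} := Finset.erase_insert (by simp [h.ne])
  have hyx : ({x, y} : Finset V).erase y = {x} := by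
    rw [Finset.pair_comm, Finset.erase_insert (by simp [h.ne'])]
  rw [boundary_single, Finset.sum_pair h.ne, hx, hy, hxy, hyx, mul_one, mul_neg_one,
    Finsupp.single_neg, sub_eq_add_neg]

/-- The oriented join of the vertex `x` with a chain. It contracts the augmented chain complex of
all finite sets. -/
noncomputable def joinVertex (x : V) : (Finset V →₀ k) →ₗ[k] (Finset V →₀ k) :=
  Finsupp.linearCombination k fun s : Finset V =>
    if x ∈ s then 0 else Finsupp.single (insert x s) (incidenceSign k x s)

theorem joinVertex_single_of_mem {x : V} {s : Finset V} (h : x ∈ s) (c : k) :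
    joinVertex k x (Finsupp.single s c) = 0 := by
  simp [joinVertex, h]

theorem joinVertex_single_of_notMem {x : V} {s : Finset V} (h : x ∉ s) (c : k) :
    joinVertex k x (Finsupp.single s c) =
      Finsupp.single (insert x s) (c * incidenceSign k x s) := by
  simp [joinVertex, h]

theorem joinVertex_boundary_single_of_mem {x : V} {s : Finset V} (hx : x ∈ s) (c : k) :
    joinVertex k x (boundary k (Finsupp.single s c)) = Finsupp.single s c := by
  have hsign : incidenceSign k x s = incidenceSign k x (s.erase x) := by
    conv_lhs => rw [← Finset.insert_erase hx, incidenceSign_insert_self]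
  rw [boundary_single, map_sum, Finset.sum_eq_single_of_mem x hx fun y _ hyx =>
      joinVertex_single_of_mem k (Finset.mem_erase.2 ⟨hyx.symm, hx⟩) _,
    joinVertex_single_of_notMem k (Finset.notMem_erase x s), Finset.insert_erase hx, hsign,
    mul_assoc, incidenceSign_mul_self, mul_one]

theorem boundary_joinVertex_single_of_notMem {x : V} {s : Finset V} (hx : x ∉ s) (c : k) :
    boundary k (joinVertex k x (Finsupp.single s c)) =
      Finsupp.single s c - joinVertex k x (boundary k (Finsupp.single s c)) := by
  have hterm : ∀ y ∈ s, Finsupp.single ((insert x s).erase y)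
      (c * incidenceSign k x s * incidenceSign k y (insert x s)) =
      -joinVertex k x (Finsupp.single (s.erase y) (c * incidenceSign k y s)) := by
    intro y hy
    obtain ⟨t, hyt, rfl⟩ : ∃ t, y ∉ t ∧ insert y t = s :=
      ⟨s.erase y, Finset.notMem_erase y s, Finset.insert_erase hy⟩
    obtain ⟨hxy, hxt⟩ : x ≠ y ∧ x ∉ t := by simpa using hx
    rw [Finset.erase_insert_of_ne hxy, Finset.erase_insert hyt, joinVertex_single_of_notMem k hxt,
      ← Finsupp.single_neg, mul_assoc, mul_assoc,
      incidenceSign_mul_incidenceSign_insert k hxy hxt hyt, mul_neg]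
  rw [joinVertex_single_of_notMem k hx, boundary_single, boundary_single, map_sum,
    Finset.sum_insert hx, Finset.erase_insert hx, incidenceSign_insert_self, mul_assoc,
    incidenceSign_mul_self, mul_one, Finset.sum_congr rfl hterm, Finset.sum_neg_distrib,
    sub_eq_add_neg]

theorem boundary_joinVertex_add (x : V) (c : Finset V →₀ k) :
    boundary k (joinVertex k x c) + joinVertex k x (boundary k c) = c := by
  induction c using Finsupp.induction_linear with
  | zero => simp
  | add c d hc hd =>
    rw [map_add, map_add, map_add, map_add, add_add_add_comm, hc, hd]
  | single s a =>
    by_cases hx : x ∈ s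
    · rw [joinVertex_single_of_mem k hx, map_zero, zero_add,
        joinVertex_boundary_single_of_mem k hx]
    · rw [boundary_joinVertex_single_of_notMem k hx, sub_add_cancel]

theorem boundary_boundary (c : Finset V →₀ k) : boundary k (boundary k c) = 0 := by
  induction c using Finsupp.induction_linear with
  | zero => simp
  | add c d hc hd => rw [map_add, map_add, hc, hd, add_zero]
  | single s a =>
    induction s using Finset.induction_on generalizing a with
    | empty => simp [boundary_single]
    | insert x s hx ih =>
      have hjoin : Finsupp.single (insert x s) a =
          joinVertex k x (Finsupp.single s (a * incidenceSign k x s)) := by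
        rw [joinVertex_single_of_notMem k hx, mul_assoc, incidenceSign_mul_self, mul_one]
      set c := Finsupp.single s (a * incidenceSign k x s)
      have hcone := boundary_joinVertex_add k x (boundary k c)
      rw [ih, map_zero, add_zero] at hcone
      rw [hjoin, eq_sub_of_add_eq (boundary_joinVertex_add k x c), map_sub, hcone, sub_self]

variable {k} {S T : Set (Finset V)} {i : ℤ} {c : Finset V →₀ k}

theorem boundary_mem_familyChains (h : ∀ s ∈ S, ∀ x ∈ s, s.erase x ∈ T)
    (hc : c ∈ familyChains k S i) : boundary k c ∈ familyChains k T (i - 1) := by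
  refine linearCombination_mem_of_mem_familyChains (fun s hs hi => ?_) hc
  refine Submodule.sum_mem _ fun x hx => Finsupp.single_mem_supported k _ ⟨h s hs x hx, ?_⟩
  have := Finset.card_erase_add_one hx
  omega

theorem joinVertex_mem_familyChains {x : V} (h : ∀ s ∈ S, insert x s ∈ T)
    (hc : c ∈ familyChains k S i) : joinVertex k x c ∈ familyChains k T (i + 1) := by
  refine linearCombination_mem_of_mem_familyChains (fun s hs hi => ?_) hc
  split_ifs with hx
  · exact Submodule.zero_mem _
  · refine Finsupp.single_mem_supported k _ ⟨h s hs, ?_⟩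
    rw [Finset.card_insert_of_notMem hx]
    push_cast
    omega

theorem exists_sub_boundary_mem_familyChains_of_cone (hS : IsLowerSet S) {F : Finset V} {y : V}
    (hy : y ∈ F) (hcone : ∀ s ∈ S, s ⊆ F → insert y s ∈ S)
    (hc : c ∈ familyChains k (S ∪ Set.Iic F) i) (hc0 : boundary k c = 0) :
    ∃ w ∈ familyChains k (Set.Iic F) (i + 1), c - boundary k w ∈ familyChains k S i := by
  rw [familyChains_union] at hc
  obtain ⟨c₀, hc₀, c₁, hc₁, rfl⟩ := Submodule.mem_sup.1 hc
  have herase : ∀ {S : Set (Finset V)}, IsLowerSet S → ∀ s ∈ S, ∀ x ∈ s, s.erase x ∈ S :=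
    fun hS s hs x _ => hS (s.erase_subset x) hs
  have hbdF : boundary k c₁ ∈ familyChains k (Set.Iic F) (i - 1) :=
    boundary_mem_familyChains (herase (isLowerSet_Iic F)) hc₁
  have hbdS : boundary k c₁ ∈ familyChains k S (i - 1) := by
    rw [map_add] at hc0
    rw [eq_neg_of_add_eq_zero_right hc0]
    exact Submodule.neg_mem _ (boundary_mem_familyChains (herase hS) hc₀)
  have hjoin : joinVertex k y (boundary k c₁) ∈ familyChains k S i := by
    have hbd : boundary k c₁ ∈ familyChains k (S ∩ Set.Iic F) (i - 1) := by
      rw [familyChains_inter]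
      exact ⟨hbdS, hbdF⟩
    simpa only [sub_add_cancel] using
      joinVertex_mem_familyChains (fun s hs => hcone s hs.1 hs.2) hbd
  refine ⟨joinVertex k y c₁,
    joinVertex_mem_familyChains (fun s hs => Finset.insert_subset hy hs) hc₁, ?_⟩
  rw [eq_sub_of_add_eq (boundary_joinVertex_add k y c₁), add_sub_assoc, sub_sub_cancel]
  exact Submodule.add_mem _ hc₀ hjoin

-- If some `F.erase y` is missing from `S`, then the simplices of `F` in `S` form a cone with
-- apex `y`. Otherwise the only new simplex is `F`, whose dimension exceeds `i`.
theorem exists_sub_boundary_mem_familyChains (hS : IsLowerSet S) {F : Finset V}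
    (hF : ∀ s ∈ S, s ⊆ F → ∃ x ∈ F \ s, F.erase x ∈ S) (hi : i < (F.card : ℤ) - 1)
    (hc : c ∈ familyChains k (S ∪ Set.Iic F) i) (hc0 : boundary k c = 0) :
    ∃ w ∈ familyChains k (Set.Iic F) (i + 1), c - boundary k w ∈ familyChains k S i := by
  by_cases! hall : ∀ y ∈ F, F.erase y ∈ S
  · refine ⟨0, Submodule.zero_mem _, ?_⟩
    rw [map_zero, sub_zero]
    refine familyChains_mono (fun s hs hcard => hs.elim id fun hsF => ?_) hc
    obtain ⟨y, hyF, hys⟩ := Finset.exists_mem_notMem_of_card_lt_card (s := s) (t := F) (by omega)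
    exact hS (Finset.subset_erase.2 ⟨hsF, hys⟩) (hall y hyF)
  · obtain ⟨y, hy, hyS⟩ := hall
    refine exists_sub_boundary_mem_familyChains_of_cone hS hy (fun s hs hsF => ?_) hc hc0
    obtain ⟨x, hx, hxS⟩ := hF s hs hsF
    rw [Finset.mem_sdiff] at hx
    have hxy : x ≠ y := fun h => hyS (h ▸ hxS)
    exact hS (Finset.subset_erase.2 ⟨Finset.insert_subset hy hsF, by simp [hxy, hx.2]⟩) hxS

theorem exists_boundary_eq_of_shelling {t : ℕ} {E : Fin t → Finset V}
    (hcard : ∀ j, i < ((E j).card : ℤ) - 1)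
    (hshell : ∀ a j, j < a → ∃ x ∈ E a \ E j, ∃ l, l < a ∧ E a \ E l = {x}) {m : ℕ} (hm : m ≤ t)
    (hc : c ∈ familyChains k {s | ∃ j : Fin t, (j : ℕ) < m ∧ s ⊆ E j} i) (hc0 : boundary k c = 0) :
    ∃ w ∈ familyChains k {s | ∃ j, s ⊆ E j} (i + 1), boundary k w = c := by
  induction m generalizing c with
  | zero =>
    have hempty : c ∈ familyChains k ∅ i :=
      familyChains_mono (by rintro s ⟨j, hj, _⟩; exact absurd hj (Nat.not_lt_zero _)) hc
    have hczero : c = 0 := by simpa [familyChains] using hempty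
    exact ⟨0, Submodule.zero_mem _, by rw [map_zero, hczero]⟩
  | succ m ih =>
    let a : Fin t := ⟨m, hm⟩
    let S : Set (Finset V) := {s | ∃ j : Fin t, (j : ℕ) < m ∧ s ⊆ E j}
    have hS : IsLowerSet S := fun s u hus ⟨j, hj, hs⟩ => ⟨j, hj, hus.trans hs⟩
    have hunion : c ∈ familyChains k (S ∪ Set.Iic (E a)) i := by
      refine familyChains_mono ?_ hc
      rintro s ⟨j, hj, hs⟩ -
      rcases (Nat.lt_succ_iff.1 hj).lt_or_eq with hlt | heq
      · exact Or.inl ⟨j, hlt, hs⟩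
      · exact Or.inr ((Fin.ext heq : j = a) ▸ hs)
    have hinter : ∀ s ∈ S, s ⊆ E a → ∃ x ∈ E a \ s, (E a).erase x ∈ S := by
      rintro s ⟨j, hj, hs⟩ _
      obtain ⟨x, hx, l, hl, hd⟩ := hshell a j hj
      refine ⟨x, Finset.sdiff_subset_sdiff subset_rfl hs hx, l, hl, ?_⟩
      rw [← Finset.sdiff_singleton_eq_erase, ← hd, sdiff_sdiff_right_self]
      exact inf_le_right
    obtain ⟨w, hw, hcw⟩ := exists_sub_boundary_mem_familyChains hS hinter (hcard a) hunion hc0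
    obtain ⟨v, hv, hvc⟩ := ih (by omega) hcw (by rw [map_sub, hc0, boundary_boundary, sub_zero])
    have hw' : w ∈ familyChains k {s | ∃ j, s ⊆ E j} (i + 1) :=
      familyChains_mono (by rintro s hs -; exact ⟨a, hs⟩) hw
    exact ⟨v + w, Submodule.add_mem _ hv hw', by rw [map_add, hvc, sub_add_cancel]⟩

variable {Δ : SimpComplex V}

theorem subsingleton_reducedHomology_iff :
    Subsingleton (Δ.ReducedHomology k i) ↔
      ∀ z ∈ Δ.chains k i, boundary k z = 0 → ∃ w ∈ Δ.chains k (i + 1), boundary k w = z := by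
  rw [Submodule.subsingleton_iff_eq_bot, ← le_bot_iff, Submodule.map_le_iff_le_comap,
    Submodule.comap_bot, Submodule.ker_mkQ]
  exact ⟨fun h z hz hz0 => h ⟨hz, hz0⟩, fun h z hz => h z hz.1 hz.2⟩

theorem Shellable.subsingleton_reducedHomology (h : Δ.Shellable) (hi : i < Δ.dim) :
    Subsingleton (Δ.ReducedHomology k i) := by
  obtain ⟨hpure, t, E, -, hfacet, hshell⟩ := h
  have hE : ∀ j, Δ.IsFacet (E j) := fun j => (hfacet _).2 ⟨j, rfl⟩
  refine subsingleton_reducedHomology_iff.2 fun z hz hz0 => ?_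
  have hz' : z ∈ familyChains k {s | ∃ j : Fin t, (j : ℕ) < t ∧ s ⊆ E j} i := by
    refine familyChains_mono (fun s hs _ => ?_) hz
    obtain ⟨G, hG, hsG⟩ := exists_isFacet_superset hs
    obtain ⟨j, rfl⟩ := (hfacet G).1 hG
    exact ⟨j, j.isLt, hsG⟩
  obtain ⟨w, hw, hwz⟩ := exists_boundary_eq_of_shelling (fun j => hpure.dim_eq (hE j) ▸ hi) hshell
    le_rfl hz' hz0
  refine ⟨w, familyChains_mono ?_ hw, hwz⟩
  rintro s ⟨j, hj⟩ -
  exact Δ.down_closed _ (hE j).1 s hj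

theorem not_subsingleton_reducedHomology_zero (A : Set V)
    (hA : ∀ x y, {x, y} ∈ Δ.faces → x ∈ A → y ∈ A) {u v : V} (hu : {u} ∈ Δ.faces)
    (hv : {v} ∈ Δ.faces) (huA : u ∈ A) (hvA : v ∉ A) :
    ¬ Subsingleton (Δ.ReducedHomology k 0) := by
  classical
  -- The sum of the coefficients of the vertices in `A` vanishes on boundaries.
  let f : (Finset V →₀ k) →ₗ[k] k :=
    Finsupp.linearCombination k fun s : Finset V => if ∃ x ∈ A, s = {x} then 1 else 0
  have hf : ∀ x, f (Finsupp.single {x} 1) = if x ∈ A then 1 else 0 := fun x => by simp [f]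
  have hf_pair : ∀ x y, x < y → {x, y} ∈ Δ.faces →
      f (boundary k (Finsupp.single {x, y} 1)) = 0 := by
    intro x y hxy hmem
    have hiff : x ∈ A ↔ y ∈ A := ⟨hA x y hmem, hA y x (Finset.pair_comm x y ▸ hmem)⟩
    rw [boundary_single_pair k hxy, map_sub, hf, hf]
    simp [hiff]
  have hf_boundary : ∀ w ∈ Δ.chains k 1, f (boundary k w) = 0 := by
    intro w hw
    change w ∈ familyChains k (Δ.faces : Set (Finset V)) 1 at hw
    rw [← LinearMap.mem_ker]
    refine linearCombination_mem_of_mem_familyChains (fun s hs hcard => ?_) hw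
    obtain ⟨x, y, hxy, rfl⟩ := Finset.card_eq_two.1 (by omega : s.card = 2)
    rw [LinearMap.mem_ker]
    rcases hxy.lt_or_gt with h | h
    · simpa [boundary_single, incidenceSign] using hf_pair x y h hs
    · have := hf_pair y x h (Finset.pair_comm x y ▸ hs)
      simpa [boundary_single, incidenceSign, Finset.pair_comm x y] using this
  intro hsub
  obtain ⟨w, hw, hwz⟩ := subsingleton_reducedHomology_iff.1 hsub
    (Finsupp.single {u} 1 - Finsupp.single {v} 1)
    (Submodule.sub_mem _ (Finsupp.single_mem_supported k _ ⟨hu, by simp⟩)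
      (Finsupp.single_mem_supported k _ ⟨hv, by simp⟩))
    (by rw [map_sub, boundary_single_singleton, boundary_single_singleton, sub_self])
  have h0 := hf_boundary w hw
  rw [hwz, map_sub, hf, hf, if_pos huA, if_neg hvA, sub_zero] at h0
  exact one_ne_zero h0

end Homology

section CohenMacaulay

variable {k : Type*} [Field k] {V : Type*} [LinearOrder V] {Δ : SimpComplex V} {F : Finset V}

theorem Shellable.cohenMacaulay (h : Δ.Shellable) : Δ.CohenMacaulay k :=
  ⟨h.1, fun _ hF _ hi => (h.link hF).subsingleton_reducedHomology hi⟩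

theorem CohenMacaulay.link (h : Δ.CohenMacaulay k) (hF : F ∈ Δ.faces) :
    (Δ.link F hF).CohenMacaulay k := by
  refine ⟨h.1.link hF, fun G hG i hi => ?_⟩
  rw [link_link] at hi ⊢
  exact h.2 _ _ i hi

theorem CohenMacaulay.buchsbaum (h : Δ.CohenMacaulay k) : Δ.Buchsbaum k :=
  ⟨h.1, fun _ hx => h.link hx⟩

theorem CohenMacaulay.subsingleton_reducedHomology (h : Δ.CohenMacaulay k) {i : ℤ}
    (hi : i < Δ.dim) : Subsingleton (Δ.ReducedHomology k i) := by
  have := h.2 ∅ Δ.empty_mem i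
  rw [link_empty] at this
  exact this hi

theorem Buchsbaum.cohenMacaulay_link (h : Δ.Buchsbaum k) (hF : F ∈ Δ.faces) (hne : F.Nonempty) :
    (Δ.link F hF).CohenMacaulay k := by
  obtain ⟨x, hx⟩ := hne
  have hx' : {x} ∈ Δ.faces := Δ.down_closed F hF _ (Finset.singleton_subset_iff.2 hx)
  have hF' : {x} ∪ F.erase x = F := by rw [← Finset.insert_eq, Finset.insert_erase hx]
  have hmem : F.erase x ∈ (Δ.link {x} hx').faces := mem_link.2 ⟨by simp, by rwa [hF']⟩
  simpa only [link_link, hF'] using (h.2 x hx').link hmem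

end CohenMacaulay

section FiberJoin

variable {V C D : Type*}

open Classical in
/-- The complex on the vertex set `W` whose faces meet, over each value of `f`, at most one fibre
of `q`. It is the join, over the values of `f`, of the disjoint unions of the simplices on the
fibres of `q` (in `W`) above that value. -/
noncomputable def fiberJoin (W : Finset V) (q : V → D) (f : D → C) : SimpComplex V where
  faces := W.powerset.filter fun F => ∀ u ∈ F, ∀ v ∈ F, f (q u) = f (q v) → q u = q v
  empty_mem := by simp
  down_closed := by
    intro F hF G hGF
    simp only [Finset.mem_filter, Finset.mem_powerset] at hF ⊢
    exact ⟨hGF.trans hF.1, fun u hu v hv => hF.2 u (hGF hu) v (hGF hv)⟩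

variable {W : Finset V} {q : V → D} {f : D → C} {F : Finset V} {u v x : V}

theorem mem_fiberJoin : F ∈ (fiberJoin W q f).faces ↔
    F ⊆ W ∧ ∀ u ∈ F, ∀ v ∈ F, f (q u) = f (q v) → q u = q v := by
  simp [fiberJoin]

theorem singleton_mem_fiberJoin (hx : x ∈ W) : {x} ∈ (fiberJoin W q f).faces :=
  mem_fiberJoin.2 (by simp [hx])

theorem fiberJoin_faces_mono {W' : Finset V} (h : W' ⊆ W) :
    (fiberJoin W' q f).faces ⊆ (fiberJoin W q f).faces := fun _ hF =>
  let ⟨hW, hq⟩ := mem_fiberJoin.1 hF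
  mem_fiberJoin.2 ⟨hW.trans h, hq⟩

theorem insert_mem_fiberJoin [DecidableEq V] (hF : F ∈ (fiberJoin W q f).faces) (hv : v ∈ W)
    (h : ∀ u ∈ F, f (q u) = f (q v) → q u = q v) : insert v F ∈ (fiberJoin W q f).faces := by
  obtain ⟨hFW, hF⟩ := mem_fiberJoin.1 hF
  refine mem_fiberJoin.2 ⟨Finset.insert_subset hv hFW, ?_⟩
  simp only [Finset.forall_mem_insert, true_implies, true_and]
  exact ⟨fun u hu huv => (h u hu huv.symm).symm, fun u hu => ⟨h u hu, hF u hu⟩⟩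

theorem exists_mem_of_isFacet_fiberJoin (hF : (fiberJoin W q f).IsFacet F) (hv : v ∈ W) :
    ∃ u ∈ F, f (q u) = f (q v) := by
  classical
  by_contra! hne
  exact hne v (hF.mem_of_insert_mem
    (insert_mem_fiberJoin hF.1 hv fun u hu h => absurd h (hne u hu))) rfl

theorem mem_of_isFacet_fiberJoin (hF : (fiberJoin W q f).IsFacet F) (hv : v ∈ W) (hu : u ∈ F)
    (h : q u = q v) : v ∈ F := by
  classical
  exact hF.mem_of_insert_mem (insert_mem_fiberJoin hF.1 hv fun t ht htv =>
    ((mem_fiberJoin.1 hF.1).2 t ht u hu (htv.trans (congrArg f h.symm))).trans h)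

theorem card_of_isFacet_fiberJoin [DecidableEq C] [DecidableEq D] {m : ℕ}
    (hm : ∀ v ∈ W, (W.filter fun u => q u = q v).card = m) (hF : (fiberJoin W q f).IsFacet F) :
    F.card = (W.image fun v => f (q v)).card * m := by
  obtain ⟨hFW, hFq⟩ := mem_fiberJoin.1 hF.1
  rw [Finset.card_eq_sum_card_fiberwise (f := fun v => f (q v))
    (t := W.image fun v => f (q v)) fun v hv => Finset.mem_image_of_mem _ (hFW hv)]
  refine Finset.sum_const_nat fun c hc => ?_
  obtain ⟨v, hv, rfl⟩ := Finset.mem_image.1 hc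
  obtain ⟨u, hu, huv⟩ := exists_mem_of_isFacet_fiberJoin hF hv
  rw [← hm u (hFW hu)]
  congr 1
  ext w
  simp only [Finset.mem_filter]
  constructor
  · exact fun ⟨hw, hwv⟩ => ⟨hFW hw, hFq w hw u hu (hwv.trans huv.symm)⟩
  · exact fun ⟨hw, hwu⟩ =>
      ⟨mem_of_isFacet_fiberJoin hF hw hu hwu.symm, (congrArg f hwu).trans huv⟩

theorem isPure_fiberJoin [DecidableEq D] {m : ℕ}
    (hm : ∀ v ∈ W, (W.filter fun u => q u = q v).card = m) : (fiberJoin W q f).IsPure := by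
  classical
  intro F G hF hG
  rw [card_of_isFacet_fiberJoin hm hF, card_of_isFacet_fiberJoin hm hG]

section DecidableEq

variable [DecidableEq V]

theorem link_fiberJoin_of_isFacet_filter {P : C → Prop} [DecidablePred P]
    (hF : (fiberJoin (W.filter fun v => P (f (q v))) q f).IsFacet F)
    (hF' : F ∈ (fiberJoin W q f).faces) :
    (fiberJoin W q f).link F hF' = fiberJoin (W.filter fun v => ¬ P (f (q v))) q f := by
  have hFP : ∀ u ∈ F, P (f (q u)) := fun u hu =>
    (Finset.mem_filter.1 ((mem_fiberJoin.1 hF.1).1 hu)).2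
  ext G
  rw [mem_link]
  constructor
  · rintro ⟨hdisj, hmem⟩
    obtain ⟨hW, hq⟩ := mem_fiberJoin.1 hmem
    refine mem_fiberJoin.2 ⟨fun v hv => ?_, fun u hu v hv =>
      hq u (Finset.mem_union_right F hu) v (Finset.mem_union_right F hv)⟩
    have hvW := hW (Finset.mem_union_right F hv)
    refine Finset.mem_filter.2 ⟨hvW, fun hP => Finset.disjoint_left.1 hdisj ?_ hv⟩
    have hvP : v ∈ W.filter fun v => P (f (q v)) := Finset.mem_filter.2 ⟨hvW, hP⟩
    obtain ⟨u, hu, huv⟩ := exists_mem_of_isFacet_fiberJoin hF hvP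
    exact mem_of_isFacet_fiberJoin hF hvP hu
      (hq u (Finset.mem_union_left G hu) v (Finset.mem_union_right F hv) huv)
  · intro hG
    obtain ⟨hGW, hGq⟩ := mem_fiberJoin.1 hG
    obtain ⟨hFW, hFq⟩ := mem_fiberJoin.1 hF'
    have hGP : ∀ v ∈ G, ¬ P (f (q v)) := fun v hv => (Finset.mem_filter.1 (hGW hv)).2
    refine ⟨Finset.disjoint_left.2 fun v hvF hvG => hGP v hvG (hFP v hvF),
      mem_fiberJoin.2 ⟨Finset.union_subset hFW (hGW.trans (W.filter_subset _)), ?_⟩⟩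
    intro u hu v hv huv
    rcases Finset.mem_union.1 hu with hu | hu <;> rcases Finset.mem_union.1 hv with hv | hv
    · exact hFq u hu v hv huv
    · exact absurd (huv ▸ hFP u hu) (hGP v hv)
    · exact absurd (huv ▸ hFP v hv) (hGP u hu)
    · exact hGq u hu v hv huv

theorem deletion_fiberJoin (W : Finset V) (q : V → D) (f : D → C) (x : V) :
    (fiberJoin W q f).deletion x = fiberJoin (W.erase x) q f := by
  ext F
  rw [mem_deletion, mem_fiberJoin, mem_fiberJoin, Finset.subset_erase]
  tauto

theorem vertexDecomposable_fiberJoin (hq : Set.InjOn q W) :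
    (fiberJoin W q f).VertexDecomposable := by
  classical
  induction W using Finset.strongInduction with
  | H W ih =>
  rcases W.eq_empty_or_nonempty with rfl | ⟨x, hx⟩
  · exact .simplex _ (isSimplex_of_mem_faces_iff (A := ∅) fun F => by
      rw [mem_fiberJoin, and_iff_left_iff_imp, Finset.subset_empty]
      rintro rfl
      simp)
  have hpure : (fiberJoin W q f).IsPure := isPure_fiberJoin (m := 1) fun v hv => by
    rw [Finset.card_eq_one]
    exact ⟨v, by ext u; simpa using ⟨fun h => hq h.1 hv h.2, by rintro rfl; exact ⟨hv, rfl⟩⟩⟩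
  have hfacet : (fiberJoin (W.filter fun v => f (q v) = f (q x)) q f).IsFacet {x} := by
    refine ⟨singleton_mem_fiberJoin (by simp [hx]), fun G hG hxG v hv => ?_⟩
    obtain ⟨hGW, hGq⟩ := mem_fiberJoin.1 hG
    have hv' := Finset.mem_filter.1 (hGW hv)
    exact Finset.mem_singleton.2
      (hq hv'.1 hx (hGq v hv x (hxG (Finset.mem_singleton_self x)) hv'.2))
  refine .shed _ hpure x (singleton_mem_fiberJoin hx) ?_ ?_
  · rw [link_fiberJoin_of_isFacet_filter (P := (· = f (q x))) hfacet]
    exact ih _ (Finset.filter_ssubset.2 ⟨x, hx, by simp⟩)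
      (hq.mono (Finset.coe_subset.2 (W.filter_subset _)))
  · rw [deletion_fiberJoin]
    exact ih _ (Finset.erase_ssubset hx) (hq.mono (Finset.coe_subset.2 (W.erase_subset x)))

theorem isSimplex_link_singleton_fiberJoin (hf : ∀ u ∈ W, ∀ v ∈ W, f (q u) = f (q v))
    (hx : {x} ∈ (fiberJoin W q f).faces) : ((fiberJoin W q f).link {x} hx).IsSimplex := by
  classical
  refine isSimplex_of_mem_faces_iff (A := (W.filter fun v => q v = q x).erase x) fun G => ?_
  have hxW : x ∈ W := (mem_fiberJoin.1 hx).1 (Finset.mem_singleton_self x)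
  rw [mem_link, mem_fiberJoin, Finset.disjoint_singleton_left, ← Finset.insert_eq,
    Finset.subset_erase, Finset.subset_iff (s₂ := W.filter _)]
  simp only [Finset.mem_filter]
  constructor
  · rintro ⟨hxG, hW, hq⟩
    refine ⟨fun v hv => ?_, hxG⟩
    have hvG : v ∈ insert x G := Finset.mem_insert_of_mem hv
    exact ⟨hW hvG, hq v hvG x (Finset.mem_insert_self x G) (hf v (hW hvG) x hxW)⟩
  · rintro ⟨hG, hxG⟩
    have hq : ∀ v ∈ insert x G, q v = q x := by
      simpa [Finset.forall_mem_insert] using fun v hv => (hG hv).2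
    exact ⟨hxG, Finset.insert_subset hxW fun v hv => (hG hv).1,
      fun u hu v hv _ => (hq u hu).trans (hq v hv).symm⟩

end DecidableEq

section LinearOrder

variable (k : Type*) [Field k] [LinearOrder V]

theorem buchsbaum_fiberJoin_of_const (hpure : (fiberJoin W q f).IsPure)
    (hf : ∀ u ∈ W, ∀ v ∈ W, f (q u) = f (q v)) : (fiberJoin W q f).Buchsbaum k :=
  ⟨hpure, fun _ hx => (VertexDecomposable.simplex _
    (isSimplex_link_singleton_fiberJoin hf hx)).shellable.cohenMacaulay⟩

theorem not_cohenMacaulay_fiberJoin_of_const (hf : ∀ u ∈ W, ∀ v ∈ W, f (q u) = f (q v))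
    {u' : V} (hu : u ∈ W) (hu' : u' ∈ W) (hv : v ∈ W) (hne : u ≠ u') (huu' : q u = q u')
    (huv : q u ≠ q v) : ¬ (fiberJoin W q f).CohenMacaulay k := by
  have hedge : {u, u'} ∈ (fiberJoin W q f).faces :=
    mem_fiberJoin.2 ⟨by simp [Finset.insert_subset_iff, hu, hu'], by simp [huu']⟩
  have hdim : 0 < (fiberJoin W q f).dim := by
    have := card_sub_one_le_dim hedge
    rw [Finset.card_pair hne] at this
    omega
  intro h
  refine not_subsingleton_reducedHomology_zero {x | q x = q u} (fun x y hxy hx => ?_)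
    (singleton_mem_fiberJoin hu) (singleton_mem_fiberJoin hv) rfl huv.symm
    (h.subsingleton_reducedHomology hdim)
  obtain ⟨hW, hq⟩ := mem_fiberJoin.1 hxy
  have hxmem : x ∈ ({x, y} : Finset V) := by simp
  have hymem : y ∈ ({x, y} : Finset V) := by simp
  exact (hq y hymem x hxmem (hf y (hW hymem) x (hW hxmem))).trans hx

theorem not_cohenMacaulay_link_fiberJoin [DecidableEq C] {u' : V} (hu : u ∈ W) (hu' : u' ∈ W)
    (hv : v ∈ W) (hne : u ≠ u') (huu' : q u = q u') (huv : q u ≠ q v) (hfuv : f (q u) = f (q v))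
    (hF : (fiberJoin (W.filter fun w => f (q w) ≠ f (q u)) q f).IsFacet F)
    (hF' : F ∈ (fiberJoin W q f).faces) : ¬ ((fiberJoin W q f).link F hF').CohenMacaulay k := by
  rw [link_fiberJoin_of_isFacet_filter (P := (· ≠ f (q u))) hF]
  refine not_cohenMacaulay_fiberJoin_of_const k (fun x hx y hy => ?_) (by simp [hu])
    (by simp [hu', huu']) (by simp [hv, hfuv]) hne huu' huv
  simp only [not_not, Finset.mem_filter] at hx hy
  exact hx.2.trans hy.2.symm

theorem not_cohenMacaulay_fiberJoin {u' : V} (hu : u ∈ W) (hu' : u' ∈ W) (hv : v ∈ W)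
    (hne : u ≠ u') (huu' : q u = q u') (huv : q u ≠ q v) (hfuv : f (q u) = f (q v)) :
    ¬ (fiberJoin W q f).CohenMacaulay k := by
  classical
  intro h
  obtain ⟨F, hF, -⟩ := exists_isFacet_superset
    (fiberJoin (W.filter fun w => f (q w) ≠ f (q u)) q f).empty_mem
  have hF' := fiberJoin_faces_mono (W.filter_subset _) hF.1
  exact not_cohenMacaulay_link_fiberJoin k hu hu' hv hne huu' huv hfuv hF hF' (h.link hF')

theorem not_buchsbaum_fiberJoin {u' w : V} (hu : u ∈ W) (hu' : u' ∈ W) (hv : v ∈ W)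
    (hw : w ∈ W) (hne : u ≠ u') (huu' : q u = q u') (huv : q u ≠ q v) (hfuv : f (q u) = f (q v))
    (hfwu : f (q w) ≠ f (q u)) : ¬ (fiberJoin W q f).Buchsbaum k := by
  classical
  intro h
  have hw' : w ∈ W.filter fun w => f (q w) ≠ f (q u) := Finset.mem_filter.2 ⟨hw, hfwu⟩
  obtain ⟨F, hF, hwF⟩ := exists_isFacet_superset (singleton_mem_fiberJoin (q := q) (f := f) hw')
  have hF' := fiberJoin_faces_mono (W.filter_subset _) hF.1
  exact not_cohenMacaulay_link_fiberJoin k hu hu' hv hne huu' huv hfuv hF hF'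
    (h.cohenMacaulay_link hF' ((Finset.singleton_nonempty w).mono hwF))

end LinearOrder

end FiberJoin

end SimpComplex
open SimpComplex

theorem card_filter_mod_eq {n d : ℕ} (hd : 0 < d) (hdn : d ∣ n) (r : ℕ) :
    (Finset.univ.filter fun u : Fin n => (u : ℕ) % d = r % d).card = n / d := by
  have hcount := Nat.count_modEq_card n hd r
  rw [Nat.mod_eq_zero_of_dvd hdn, if_neg (Nat.not_lt_zero _), add_zero] at hcount
  rw [← hcount, Nat.count_eq_card_filter_range, ← Finset.card_map Fin.valEmbedding]
  congr 1
  ext v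
  simp only [Finset.mem_map, Finset.mem_filter, Finset.mem_univ, true_and, Finset.mem_range]
  exact ⟨fun ⟨u, hu, huv⟩ => huv ▸ ⟨u.isLt, hu⟩, fun h => ⟨⟨v, h.1⟩, h.2, rfl⟩⟩

section OnePairedCirculant

variable {n : ℕ} [NeZero n] {a b : ℕ}

theorem onePairedCirculant_adj (hab : a * b ∣ n) (u v : Fin n) :
    (onePairedCirculant n a b).Adj u v ↔
      (u : ℕ) % a = v % a ∧ (u : ℕ) % (a * b) ≠ v % (a * b) := by
  wlog huv : (v : ℕ) ≤ u generalizing u v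
  · rw [SimpleGraph.adj_comm, this v u (le_of_not_ge huv), ne_comm, eq_comm]
  have := u.isLt
  rcases huv.eq_or_lt with heq | hlt
  · simp [Fin.ext heq]
  have hsub : ((u - v : Fin n) : ℕ) = u - v := Fin.sub_val_of_le huv
  have hsub' : ((v - u : Fin n) : ℕ) = n - (u - v) := by
    rw [Fin.val_sub, Nat.mod_eq_of_lt (by omega)]
    omega
  have hdvd : ∀ c, c ∣ n → (c ∣ n - ((u : ℕ) - v) ↔ c ∣ (u : ℕ) - v) := fun c hc =>
    Nat.dvd_sub_iff_right (by omega) hc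
  have hmod : ∀ c, (u : ℕ) % c = v % c ↔ c ∣ (u : ℕ) - v := fun c =>
    eq_comm.trans (Nat.modEq_iff_dvd' huv)
  simp only [onePairedCirculant, circulant, SimpleGraph.circulantGraph_adj, Set.mem_ofPred_eq,
    hsub, hsub', hdvd a (dvd_of_mul_right_dvd hab), hdvd _ hab, Ne, hmod]
  have hne : u ≠ v := fun h => hlt.ne (h ▸ rfl)
  constructor
  · rintro ⟨_, h | h⟩
    · exact h.2.2
    · exact h.2.2
  · intro h
    rcases le_or_gt ((u : ℕ) - v) (n / 2) with hle | hle
    · exact ⟨hne, Or.inl ⟨by omega, hle, h⟩⟩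
    · exact ⟨hne, Or.inr ⟨by omega, by omega, h⟩⟩

theorem indComplex_onePairedCirculant (hab : a * b ∣ n) :
    indComplex (onePairedCirculant n a b) =
      fiberJoin Finset.univ (fun v : Fin n => (v : ℕ) % (a * b)) (· % a) := by
  ext F
  rw [mem_fiberJoin]
  simp only [indComplex, Finset.mem_filter, Finset.mem_univ, true_and, Finset.subset_univ,
    SimpleGraph.isIndepSet_iff, Set.Pairwise, Finset.mem_coe, onePairedCirculant_adj hab,
    Nat.mod_mul_right_mod, not_and, not_not]
  exact ⟨fun h u hu v hv huv => (eq_or_ne u v).elim (fun he => he ▸ rfl) (h hu hv · huv),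
    fun h u hu v hv _ => h u hu v hv⟩

theorem isPure_indComplex_onePairedCirculant (hab : a * b ∣ n) :
    (indComplex (onePairedCirculant n a b)).IsPure := by
  rw [indComplex_onePairedCirculant hab]
  have hpos : 0 < a * b := Nat.pos_of_dvd_of_pos hab (NeZero.pos n)
  exact isPure_fiberJoin fun v _ => card_filter_mod_eq hpos hab v

theorem vertexDecomposable_indComplex_onePairedCirculant (h : n = a * b) :
    (indComplex (onePairedCirculant n a b)).VertexDecomposable := by
  rw [indComplex_onePairedCirculant h.symm.dvd]
  refine vertexDecomposable_fiberJoin fun u _ v _ huv => ?_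
  simpa only [← h, Nat.mod_eq_of_lt (Fin.isLt _), Fin.val_inj] using huv

variable {k : Type*} [Field k]

theorem not_cohenMacaulay_indComplex_onePairedCirculant (hb : 1 < b) (hab : a * b ∣ n)
    (hlt : a * b < n) : ¬ (indComplex (onePairedCirculant n a b)).CohenMacaulay k := by
  have hpos : 0 < a * b := Nat.pos_of_dvd_of_pos hab (NeZero.pos n)
  have ha : 0 < a := Nat.pos_of_mul_pos_right hpos
  have halt : a < a * b := (Nat.lt_mul_iff_one_lt_right ha).2 hb
  rw [indComplex_onePairedCirculant hab]
  exact not_cohenMacaulay_fiberJoin k (u := ⟨0, hpos.trans hlt⟩) (u' := ⟨a * b, hlt⟩)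
    (v := ⟨a, halt.trans hlt⟩) (Finset.mem_univ _) (Finset.mem_univ _) (Finset.mem_univ _)
    (Fin.ne_of_val_ne hpos.ne) (by simp) (by simp [Nat.mod_eq_of_lt halt, ha.ne])
    (by simp)

theorem buchsbaum_indComplex_onePairedCirculant_iff (hb : 1 < b) (hab : a * b ∣ n)
    (hlt : a * b < n) : (indComplex (onePairedCirculant n a b)).Buchsbaum k ↔ a = 1 := by
  have hpos : 0 < a * b := Nat.pos_of_dvd_of_pos hab (NeZero.pos n)
  have ha : 0 < a := Nat.pos_of_mul_pos_right hpos
  have halt : a < a * b := (Nat.lt_mul_iff_one_lt_right ha).2 hb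
  have hpure := isPure_indComplex_onePairedCirculant hab
  rw [indComplex_onePairedCirculant hab] at hpure ⊢
  constructor
  · contrapose!
    intro ha1
    have ha1 : 1 < a := by omega
    exact not_buchsbaum_fiberJoin k (u := ⟨0, hpos.trans hlt⟩) (u' := ⟨a * b, hlt⟩)
      (v := ⟨a, halt.trans hlt⟩) (w := ⟨1, ha1.trans (halt.trans hlt)⟩) (Finset.mem_univ _)
      (Finset.mem_univ _) (Finset.mem_univ _) (Finset.mem_univ _)
      (Fin.ne_of_val_ne hpos.ne) (by simp) (by simp [Nat.mod_eq_of_lt halt, ha.ne])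
      (by simp) (by simp [Nat.mod_eq_of_lt ha1])
  · rintro rfl
    exact buchsbaum_fiberJoin_of_const k hpure fun u _ v _ => by simp only [Nat.mod_one]

end OnePairedCirculant

theorem corollary5p9 (k : Type*) [Field k] (n : ℕ) [NeZero n] (a b : ℕ)
    (ha : 0 < a) (hb : 0 < b) (hab : a * b ∣ n) (hb1 : b = 1 → n = a) :
    (((indComplex (onePairedCirculant n a b)).VertexDecomposable ↔ n = a * b) ∧
      ((indComplex (onePairedCirculant n a b)).Shellable ↔ n = a * b) ∧
      ((indComplex (onePairedCirculant n a b)).CohenMacaulay k ↔ n = a * b)) ∧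
    (((indComplex (onePairedCirculant n a b)).Buchsbaum k ∧
        ¬ (indComplex (onePairedCirculant n a b)).CohenMacaulay k) ↔ a = 1 ∧ a * b < n) ∧
    (((indComplex (onePairedCirculant n a b)).IsPure ∧
        ¬ (indComplex (onePairedCirculant n a b)).Buchsbaum k) ↔ 1 < a ∧ a * b < n) := by
  have hpure := isPure_indComplex_onePairedCirculant hab
  rcases (Nat.le_of_dvd (NeZero.pos n) hab).eq_or_lt with heq | hlt
  · have hVD := vertexDecomposable_indComplex_onePairedCirculant heq.symm
    have hCM := hVD.shellable.cohenMacaulay (k := k)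
    exact ⟨⟨iff_of_true hVD heq.symm, iff_of_true hVD.shellable heq.symm,
        iff_of_true hCM heq.symm⟩,
      iff_of_false (fun h => h.2 hCM) fun h => h.2.ne heq,
      iff_of_false (fun h => h.2 hCM.buchsbaum) fun h => h.2.ne heq⟩
  · have hb' : 1 < b := lt_of_le_of_ne hb fun h => hlt.ne (by rw [← h, mul_one, hb1 h.symm])
    have hCM := not_cohenMacaulay_indComplex_onePairedCirculant (k := k) hb' hab hlt
    have hB := buchsbaum_indComplex_onePairedCirculant_iff (k := k) hb' hab hlt
    have hSh := fun h : (indComplex (onePairedCirculant n a b)).Shellable => hCM h.cohenMacaulay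
    refine ⟨⟨iff_of_false (fun h => hSh h.shellable) hlt.ne', iff_of_false hSh hlt.ne',
      iff_of_false hCM hlt.ne'⟩, ?_, ?_⟩
    · rw [hB, and_iff_left hCM, and_iff_left hlt]
    · rw [hB, and_iff_right hpure, and_iff_left hlt]
      omega
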